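/- Let $r\ge 1$ and $s\ge 2$ be integers, and let $P_1,\dots,P_s\in\mathbb{Z}[x_1,\dots,x_r]$ be nonzero polynomials that are coprime over $\mathbb{Q}$, i.e. no polynomial $D\in\mathbb{Q}[x_1,\dots,x_r]$ with $\deg D>0$ divides each of $P_1,\dots,P_s$. Let $$\mathcal{R}=\{\underline n\in\mathbb{Z}^r : \gcd(P_1(\underline n),\dots,P_s(\underline n))=1\},$$ and for each prime $p$ let $$c_p=\#\{\underline n\in(\mathbb{Z}/p\mathbb{Z})^r : P_1(\underline n)=\dots=P_s(\underline n)=0 \text{ in } \mathbb{Z}/p\mathbb{Z}\}.$$ Then the product $\prod_p\left(1-\frac{c_p}{p^r}\right)$ over all primes $p$ converges (unconditionally; its value may be $0$), the limit below exists, and $$\lim_{B\to+\infty}\frac{\#\left(\mathcal{R}\cap\{0,1,\dots,B-1\}^r\right)}{B^r}=\prod_{p\text{ prime}}\left(1-\frac{c_p}{p^r}\right).$$ -/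

import Mathlib

namespace EkedahlPoonen

/-- A finite family of polynomials over `ℤ` is coprime (over the field `ℚ`): no polynomial of
positive degree in `ℚ[x₁,…,x_r]` divides all of its members. -/
def CoprimePolys {r s : ℕ} (P : Fin s → MvPolynomial (Fin r) ℤ) : Prop :=
  ¬ ∃ D : MvPolynomial (Fin r) ℚ, 0 < D.totalDegree ∧
    ∀ i, D ∣ MvPolynomial.map (Int.castRingHom ℚ) (P i)

/-- The set of integer points at which the values of the family are (setwise) coprime. -/
def coprimeValueSet {r s : ℕ} (P : Fin s → MvPolynomial (Fin r) ℤ) : Set (Fin r → ℤ) :=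
  {n | Finset.univ.gcd (fun i => MvPolynomial.eval n (P i)) = 1}

/-- The box `{0, …, B - 1}^r` in `ℤ^r`. -/
noncomputable def box (r B : ℕ) : Finset (Fin r → ℤ) :=
  Fintype.piFinset fun _ => Finset.Ico (0 : ℤ) (B : ℤ)

/-- The set `S ⊆ ℤ^r` has natural density `d` (the limit exists and equals `d`), computed along
the boxes `{0, …, B - 1}^r`. -/
def HasDensity {r : ℕ} (S : Set (Fin r → ℤ)) (d : ℝ) : Prop :=
  Filter.Tendsto
    (fun B : ℕ => ((S ∩ (box r B : Set (Fin r → ℤ))).ncard : ℝ) / ((box r B).card : ℝ))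
    Filter.atTop (nhds d)

/-- The number of common zeros in `(ℤ/pℤ)^r` of the reductions of the family modulo `p`. -/
noncomputable def commonZeros {r s : ℕ} (P : Fin s → MvPolynomial (Fin r) ℤ) (p : ℕ) : ℕ :=
  Set.ncard {x : Fin r → ZMod p |
    ∀ i, MvPolynomial.eval x (MvPolynomial.map (Int.castRingHom (ZMod p)) (P i)) = 0}

end EkedahlPoonen

namespace EkedahlPoonen

/-! For finitely many primes, asking that none divides all values is a condition modulo their
product, so the Chinese remainder theorem gives its density as a finite product
(`hasDensity_sievedSet`). The difficulty is the tail: points where some prime `p > M` divides all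
values must have upper density tending to 0 as `M` grows, although `p` may far exceed `B`.

This is `isThin_of_no_common_divisor`, by induction on the number of variables. Gauss's lemma puts a
nonzero `g` free of the first variable into the ideal, so a prime that is bad at a point of the line
over `a` divides `g(a)`. Either it divides all coefficients at `a`, which the induction covers, or
it has few bad points on the line: O(B/p) if `p ≤ B`, O(1) if `p > B`. As `p ∣ g(a)` on O(B^r/p) of
the lines, primes in `(M, B]` cost O(B^(r+1) ∑ 1/p²), while a nonzero `g(a)` has O(1) prime factors
above `B`.

Thinness also yields convergence of the product (`summable_commonZeros`), without estimating the
number of zeros modulo `p` directly. -/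

/-! ### Elimination of one variable by Gauss's lemma -/

open Polynomial in
/-- A set of polynomials over a unique factorization domain without a common divisor of positive
degree generates an ideal that contains a nonzero constant. -/
theorem exists_C_mem_span_of_no_common_divisor {A : Type*} [CommRing A] [IsDomain A]
    [UniqueFactorizationMonoid A] (S : Set A[X])
    (hS : ∀ D : A[X], (∀ f ∈ S, D ∣ f) → D.natDegree = 0) :
    ∃ g : A, g ≠ 0 ∧ C g ∈ Ideal.span S := by
  classical
  let : NormalizedGCDMonoid A := Nonempty.some inferInstance
  let K := FractionRing A
  let φ : A[X] →+* K[X] := mapRingHom (algebraMap A K)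
  obtain ⟨h, hh⟩ := IsPrincipalIdealRing.principal ((Ideal.span S).map φ)
  have hdvd : ∀ f ∈ S, h ∣ f.map (algebraMap A K) := fun f hf => by
    have : φ f ∈ (Ideal.span S).map φ := Ideal.mem_map_of_mem _ (Ideal.subset_span hf)
    rw [hh] at this
    exact Ideal.mem_span_singleton.1 this
  have h0 : h ≠ 0 := by
    rintro rfl
    -- If the extended ideal were zero, every member of `S` would be 0 and `X` would be a common
    -- divisor.
    have : (X : A[X]).natDegree = 0 := hS X fun f hf => by
      have h1 := zero_dvd_iff.1 (hdvd f hf)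
      rw [Polynomial.map_eq_zero_iff (IsFractionRing.injective A K)] at h1
      simp [h1]
    simp at this
  obtain ⟨b, hb, hbN⟩ := IsLocalization.integerNormalization_spec (nonZeroDivisors A) h
  set N := IsLocalization.integerNormalization (nonZeroDivisors A) h
  have hN0 : N ≠ 0 := by
    rwa [Ne, IsFractionRing.integerNormalization_eq_zero_iff]
  have hb0 : algebraMap A K b ≠ 0 := by
    simpa using nonZeroDivisors.ne_zero hb
  rw [Algebra.smul_def, Polynomial.algebraMap_apply] at hbN
  have hprim : N.primPart.map (algebraMap A K) ∣ h := by
    have h1 : N.primPart.map (algebraMap A K) ∣ N.map (algebraMap A K) :=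
      Polynomial.map_dvd _ N.primPart_dvd
    rw [hbN] at h1
    exact (IsUnit.dvd_mul_left ((isUnit_C).2 (isUnit_iff_ne_zero.2 hb0))).1 h1
  -- By Gauss's lemma the primitive part of `N` divides `S` already over `A`, so the generator `h`
  -- is a unit of `K[X]`.
  have hdeg : h.natDegree = 0 := by
    have h1 := hS N.primPart fun f hf =>
      N.isPrimitive_primPart.dvd_of_fraction_map_dvd_fraction_map
        (hprim.trans (hdvd f hf))
    rw [natDegree_primPart] at h1
    have h2 := congrArg natDegree hbN
    rw [natDegree_map_eq_of_injective (IsFractionRing.injective A K), h1,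
      natDegree_C_mul hb0] at h2
    exact h2.symm
  have hone : (1 : K[X]) ∈ (Ideal.span S).map φ := by
    rw [hh]
    refine Ideal.mem_span_singleton.2 (IsUnit.dvd ?_)
    rw [eq_C_of_natDegree_eq_zero hdeg] at h0 ⊢
    exact isUnit_C.2 (isUnit_iff_ne_zero.2 fun h => h0 (by rw [h, C_0]))
  let : Algebra A[X] K[X] := Polynomial.algebra A K
  have hloc := Polynomial.isLocalization (nonZeroDivisors A) K
  obtain ⟨⟨i, ⟨_, g, hg, rfl⟩⟩, hi⟩ :=
    (IsLocalization.mem_map_algebraMap_iff ((nonZeroDivisors A).map (C : A →+* A[X])) K[X]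
      (I := Ideal.span S) (z := 1)).1 hone
  refine ⟨g, nonZeroDivisors.ne_zero hg, ?_⟩
  have hinj : Function.Injective (algebraMap A[X] K[X]) :=
    Polynomial.map_injective _ (IsFractionRing.injective A K)
  rw [one_mul] at hi
  have := hinj hi
  simp only at this
  rw [this]
  exact i.2

/-! ### Residue classes in boxes and sizes of values -/

theorem card_box (r B : ℕ) : (box r B).card = B ^ r := by
  simp [box, Fintype.card_piFinset]

theorem mem_box {r B : ℕ} {n : Fin r → ℤ} : n ∈ box r B ↔ ∀ i, 0 ≤ n i ∧ n i < B := by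
  simp [box, Fintype.mem_piFinset]

/-- The number of integers in `[0, B)` in a residue class modulo `m`. -/
theorem card_filter_intCast_eq (m B : ℕ) [NeZero m] (t : ZMod m) :
    B / m ≤ ((Finset.Ico (0 : ℤ) B).filter fun x : ℤ => (x : ZMod m) = t).card ∧
      ((Finset.Ico (0 : ℤ) B).filter fun x : ℤ => (x : ZMod m) = t).card ≤ B / m + 1 := by
  have h : ((Finset.Ico (0 : ℤ) B).filter fun x : ℤ => (x : ZMod m) = t).card =
      Nat.count (fun x => x ≡ t.val [MOD m]) B := by
    rw [Nat.count_eq_card_filter_range]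
    symm
    refine Finset.card_bij (fun a _ => (a : ℤ)) ?_ ?_ ?_
    · intro a ha
      simp only [Finset.mem_filter, Finset.mem_range, Finset.mem_Ico] at ha ⊢
      refine ⟨⟨by positivity, by exact_mod_cast ha.1⟩, ?_⟩
      have := (ZMod.natCast_eq_natCast_iff _ _ _).2 ha.2
      simpa using this
    · intro a _ b _ hab
      exact_mod_cast hab
    · intro b hb
      simp only [Finset.mem_filter, Finset.mem_Ico] at hb
      lift b to ℕ using hb.1.1
      refine ⟨b, ?_, rfl⟩
      simp only [Finset.mem_filter, Finset.mem_range]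
      refine ⟨by exact_mod_cast hb.1.2, (ZMod.natCast_eq_natCast_iff _ _ _).1 ?_⟩
      simpa using hb.2
  rw [h, Nat.count_modEq_card B (NeZero.pos m)]
  split_ifs <;> omega

open Classical in
/-- The number of points of a box whose reduction modulo `m` lies in a given set `T`. -/
theorem card_box_filter_reduction {r : ℕ} (m B : ℕ) [NeZero m] (T : Finset (Fin r → ZMod m)) :
    T.card * (B / m) ^ r ≤ ((box r B).filter fun n => (fun i => (n i : ZMod m)) ∈ T).card ∧
      ((box r B).filter fun n => (fun i => (n i : ZMod m)) ∈ T).card ≤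
        T.card * (B / m + 1) ^ r := by
  have h : ((box r B).filter fun n => (fun i => (n i : ZMod m)) ∈ T).card =
      ∑ t ∈ T, ∏ i, ((Finset.Ico (0 : ℤ) B).filter fun x : ℤ => (x : ZMod m) = t i).card := by
    rw [Finset.card_eq_sum_card_fiberwise (f := fun n => fun i => (n i : ZMod m)) (t := T)]
    · refine Finset.sum_congr rfl fun t ht => ?_
      rw [← Fintype.card_piFinset]
      congr 1
      ext n
      simp only [Finset.mem_filter, Fintype.mem_piFinset, box]
      constructor
      · rintro ⟨⟨h1, _⟩, h2⟩ i
        exact ⟨h1 i, congrFun h2 i⟩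
      · intro h1
        have h2 : (fun i => (n i : ZMod m)) = t := funext fun i => (h1 i).2
        exact ⟨⟨fun i => (h1 i).1, h2 ▸ ht⟩, h2⟩
    · intro n hn
      exact (Finset.mem_filter.1 hn).2
  rw [h, ← smul_eq_mul, ← smul_eq_mul]
  constructor
  · refine Finset.card_nsmul_le_sum _ _ _ fun t _ => ?_
    simpa using Finset.prod_le_prod' (s := (Finset.univ : Finset (Fin r)))
      fun i _ => (card_filter_intCast_eq m B (t i)).1
  · refine Finset.sum_le_card_nsmul _ _ _ fun t _ => ?_
    simpa using Finset.prod_le_prod' (s := (Finset.univ : Finset (Fin r)))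
      fun i _ => (card_filter_intCast_eq m B (t i)).2

/-- Reduction modulo `m` commutes with evaluation. -/
theorem eval_map_intCast {σ : Type*} (m : ℕ) (n : σ → ℤ) (f : MvPolynomial σ ℤ) :
    MvPolynomial.eval (fun i => (n i : ZMod m))
      (MvPolynomial.map (Int.castRingHom (ZMod m)) f) = ((MvPolynomial.eval n f : ℤ) : ZMod m) := by
  rw [MvPolynomial.eval_map]
  exact (MvPolynomial.eval₂_comp_left (Int.castRingHom (ZMod m)) (RingHom.id ℤ) n f).symm

/-- A polynomial takes values of polynomial size on boxes. -/
theorem exists_abs_eval_le {r : ℕ} (g : MvPolynomial (Fin r) ℤ) :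
    ∃ C e : ℕ, ∀ B : ℕ, 1 ≤ B → ∀ n ∈ box r B, |MvPolynomial.eval n g| ≤ C * (B : ℤ) ^ e := by
  induction g using MvPolynomial.induction_on with
  | C a => exact ⟨a.natAbs, 0, fun B _ n _ => by simp⟩
  | add f g hf hg =>
    obtain ⟨C, e, h1⟩ := hf
    obtain ⟨C', e', h2⟩ := hg
    refine ⟨C + C', max e e', fun B hB n hn => ?_⟩
    have hB' : (1 : ℤ) ≤ B := by exact_mod_cast hB
    rw [map_add]
    calc |MvPolynomial.eval n f + MvPolynomial.eval n g|
        ≤ |MvPolynomial.eval n f| + |MvPolynomial.eval n g| := abs_add_le _ _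
      _ ≤ C * (B : ℤ) ^ e + C' * (B : ℤ) ^ e' := add_le_add (h1 B hB n hn) (h2 B hB n hn)
      _ ≤ C * (B : ℤ) ^ max e e' + C' * (B : ℤ) ^ max e e' := by
        gcongr
        · exact le_max_left _ _
        · exact le_max_right _ _
      _ = _ := by push_cast; ring
  | mul_X f i hf =>
    obtain ⟨C, e, h1⟩ := hf
    refine ⟨C, e + 1, fun B hB n hn => ?_⟩
    have hn' := mem_box.1 hn i
    rw [map_mul, MvPolynomial.eval_X, abs_mul, pow_succ, ← mul_assoc]
    refine mul_le_mul (h1 B hB n hn) ?_ (abs_nonneg _) (by positivity)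
    rw [abs_of_nonneg hn'.1]
    exact hn'.2.le

/-- A nonzero integer of size at most `C * B ^ e` has at most `C + e` prime factors above `B`. -/
theorem card_primes_dvd_le {B C e : ℕ} (hB : 2 ≤ B) {N : ℤ} (hN : N ≠ 0)
    (hNB : |N| ≤ C * (B : ℤ) ^ e) (F : Finset ℕ)
    (hF : ∀ p ∈ F, p.Prime ∧ B < p ∧ (p : ℤ) ∣ N) : F.card ≤ C + e := by
  have h1 : ∏ p ∈ F, p ∣ N.natAbs :=
    Finset.prod_primes_dvd _ (fun p hp => (hF p hp).1.prime)
      fun p hp => Int.natCast_dvd.1 (hF p hp).2.2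
  have h2 : B ^ F.card ≤ N.natAbs :=
    (Finset.pow_card_le_prod F _ _ fun p hp => (hF p hp).2.1.le).trans
      (Nat.le_of_dvd (Int.natAbs_pos.2 hN) h1)
  have h3 : N.natAbs ≤ C * B ^ e := by
    zify
    exact hNB
  -- `C < B ^ C` because `B ≥ 2`.
  have h4 : C * B ^ e ≤ B ^ (C + e) := by
    rw [pow_add]
    gcongr
    exact (Nat.lt_pow_self (by omega)).le
  exact (Nat.pow_le_pow_iff_right (by omega)).1 (h2.trans (h3.trans h4))

/-! ### Bad points, and counts of zeros over ℤ and modulo `p` -/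

open Classical in
/-- The points of the box at which some prime `p > M` divides the values of all members of `S`. -/
noncomputable def badPoints {r : ℕ} (S : Set (MvPolynomial (Fin r) ℤ)) (M B : ℕ) :
    Finset (Fin r → ℤ) :=
  (box r B).filter fun n =>
    ∃ p : ℕ, p.Prime ∧ M < p ∧ ∀ f ∈ S, (p : ℤ) ∣ MvPolynomial.eval n f

/-- The upper density of the points at which a prime `p > M` divides all values tends to `0` as
`M` tends to infinity. -/
def IsThin {r : ℕ} (S : Set (MvPolynomial (Fin r) ℤ)) : Prop :=
  ∀ ε : ℝ, 0 < ε → ∃ M : ℕ, ∀ᶠ B : ℕ in Filter.atTop,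
    ((badPoints S M B).card : ℝ) ≤ ε * (B : ℝ) ^ r

theorem badPoints_anti {r : ℕ} (S : Set (MvPolynomial (Fin r) ℤ)) {M M' : ℕ} (h : M ≤ M')
    (B : ℕ) : badPoints S M' B ⊆ badPoints S M B := by
  intro n hn
  simp only [badPoints, Finset.mem_filter] at hn ⊢
  obtain ⟨h1, p, hp, hM, hd⟩ := hn
  exact ⟨h1, p, hp, h.trans_lt hM, hd⟩

theorem card_eval_eq_zero_le {r : ℕ} {g : MvPolynomial (Fin r) ℤ} (hg : g ≠ 0) (B : ℕ) :
    (((box r B).filter fun a => MvPolynomial.eval a g = 0).card : ℝ) ≤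
      g.totalDegree / B * (B : ℝ) ^ r := by
  -- For `B = 0` the bound is 0 (division by zero), so there must be no zeros at all; if also `r =
  -- 0` the box still has one point.
  rcases Nat.eq_zero_or_pos B with rfl | hB
  · rcases Nat.eq_zero_or_pos r with rfl | hr
    · have : ∀ a, MvPolynomial.eval a g ≠ 0 := by
        intro a
        rw [g.eq_C_of_isEmpty] at hg ⊢
        simpa using hg
      simp [this]
    · have : box r 0 = ∅ := by
        rw [← Finset.card_eq_zero, card_box, zero_pow hr.ne']
      simp [this]
  have h := MvPolynomial.schwartz_zippel_totalDegree hg (Finset.Ico (0 : ℤ) B)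
  rw [Int.card_Ico, sub_zero, Int.toNat_natCast] at h
  have h' : (((box r B).filter fun a => MvPolynomial.eval a g = 0).card : ℝ) / (B : ℝ) ^ r ≤
      g.totalDegree / B := by
    have h1 := (NNRat.cast_le (K := ℝ)).2 h
    push_cast at h1
    exact h1
  rwa [div_le_iff₀ (by positivity)] at h'

theorem map_intCast_ne_zero {σ : Type*} {g : MvPolynomial σ ℤ} (hg : g ≠ 0) :
    ∃ M : ℕ, ∀ p : ℕ, M < p → MvPolynomial.map (Int.castRingHom (ZMod p)) g ≠ 0 := by
  obtain ⟨m, hm⟩ := MvPolynomial.ne_zero_iff.1 hg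
  refine ⟨(g.coeff m).natAbs, fun p hp h => hm ?_⟩
  have h1 : ((g.coeff m : ℤ) : ZMod p) = 0 := by
    have := congrArg (MvPolynomial.coeff m) h
    simpa [MvPolynomial.coeff_map] using this
  rw [ZMod.intCast_zmod_eq_zero_iff_dvd, Int.natCast_dvd] at h1
  have := Nat.eq_zero_of_dvd_of_lt h1 hp
  simpa using this

theorem natCast_div_add_one_le {B p : ℕ} (hp : 0 < p) (hpB : p ≤ B) :
    ((B / p + 1 : ℕ) : ℝ) ≤ 2 * B / p := by
  have hp' : (0 : ℝ) < p := by exact_mod_cast hp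
  have h1 : ((B / p : ℕ) : ℝ) ≤ B / p := Nat.cast_div_le
  have h2 : (1 : ℝ) ≤ B / p := by
    rw [le_div_iff₀ hp', one_mul]
    exact_mod_cast hpB
  push_cast
  rw [mul_div_assoc]
  linarith

/-- Schwartz–Zippel over `ZMod p` bounds the residue classes of zeros, and `p ≤ B` lets each class
have at most `(2B/p)^r` points in the box. -/
theorem card_dvd_eval_le {r : ℕ} {g : MvPolynomial (Fin r) ℤ} {p B : ℕ} (hp : p.Prime)
    (hpB : p ≤ B) (hg : MvPolynomial.map (Int.castRingHom (ZMod p)) g ≠ 0) :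
    (((box r B).filter fun a => (p : ℤ) ∣ MvPolynomial.eval a g).card : ℝ) ≤
      g.totalDegree * 2 ^ r * (B : ℝ) ^ r / p := by
  classical
  have : Fact p.Prime := ⟨hp⟩
  have hp' : (0 : ℝ) < p := by exact_mod_cast hp.pos
  set G := MvPolynomial.map (Int.castRingHom (ZMod p)) g with hG
  set T : Finset (Fin r → ZMod p) := Finset.univ.filter fun x => MvPolynomial.eval x G = 0
  have hT : (T.card : ℝ) ≤ g.totalDegree / p * (p : ℝ) ^ r := by
    have h := MvPolynomial.schwartz_zippel_totalDegree hg (Finset.univ : Finset (ZMod p))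
    rw [Fintype.piFinset_univ, Finset.card_univ, ZMod.card] at h
    have h' : (T.card : ℝ) / (p : ℝ) ^ r ≤ G.totalDegree / p := by
      have h1 := (NNRat.cast_le (K := ℝ)).2 h
      push_cast at h1
      exact h1
    rw [div_le_iff₀ (by positivity)] at h'
    refine h'.trans ?_
    gcongr
    exact Finset.sup_mono (MvPolynomial.support_map_subset _ _)
  have h1 := (card_box_filter_reduction p B T).2
  have h2 : ((box r B).filter fun a => (p : ℤ) ∣ MvPolynomial.eval a g) =
      (box r B).filter fun n => (fun i => (n i : ZMod p)) ∈ T := by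
    refine Finset.filter_congr fun n _ => ?_
    simp only [T, Finset.mem_filter, Finset.mem_univ, true_and, hG, eval_map_intCast,
      ZMod.intCast_zmod_eq_zero_iff_dvd]
  rw [h2]
  calc _ ≤ ((T.card * (B / p + 1) ^ r : ℕ) : ℝ) := by exact_mod_cast h1
    _ = (T.card : ℝ) * ((B / p + 1 : ℕ) : ℝ) ^ r := by push_cast; ring
    _ ≤ (g.totalDegree / p * (p : ℝ) ^ r) * (2 * B / p) ^ r := by
      gcongr
      exact natCast_div_add_one_le hp.pos hpB
    _ = _ := by
      rw [div_pow, mul_pow]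
      field_simp

/-- Points of a line on which a polynomial with some coefficient prime to `p` is divisible by
`p`. -/
theorem card_line_dvd_eval_le {r : ℕ} {f : MvPolynomial (Fin (r + 1)) ℤ} {p B k d : ℕ}
    (hp : p.Prime) (a : Fin r → ℤ) (hd : f.degreeOf 0 ≤ d)
    (hk : ¬ (p : ℤ) ∣ MvPolynomial.eval a ((MvPolynomial.finSuccEquiv ℤ r f).coeff k)) :
    ((Finset.Ico (0 : ℤ) B).filter fun x =>
      (p : ℤ) ∣ MvPolynomial.eval (Fin.cons x a : Fin (r + 1) → ℤ) f).card ≤ d * (B / p + 1) := by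
  classical
  have : Fact p.Prime := ⟨hp⟩
  set q : Polynomial ℤ := (MvPolynomial.finSuccEquiv ℤ r f).map (MvPolynomial.eval a)
  set Q : Polynomial (ZMod p) := q.map (Int.castRingHom (ZMod p)) with hQ
  have hQ0 : Q ≠ 0 := by
    intro h
    have h1 := congrArg (Polynomial.coeff · k) h
    simp only [hQ, q, Polynomial.coeff_map, Polynomial.coeff_zero, Int.coe_castRingHom,
      ZMod.intCast_zmod_eq_zero_iff_dvd] at h1
    exact hk h1
  have hdeg : Q.natDegree ≤ d :=
    (Polynomial.natDegree_map_le.trans Polynomial.natDegree_map_le).trans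
      ((MvPolynomial.natDegree_finSuccEquiv f).le.trans hd)
  have hroots : Q.roots.toFinset.card ≤ d :=
    (Multiset.toFinset_card_le _).trans ((Polynomial.card_roots' Q).trans hdeg)
  have hsub : ((Finset.Ico (0 : ℤ) B).filter fun x =>
      (p : ℤ) ∣ MvPolynomial.eval (Fin.cons x a : Fin (r + 1) → ℤ) f) ⊆
      Q.roots.toFinset.biUnion fun t =>
        (Finset.Ico (0 : ℤ) B).filter fun x : ℤ => (x : ZMod p) = t := by
    intro x hx
    simp only [Finset.mem_filter, Finset.mem_biUnion, Multiset.mem_toFinset] at hx ⊢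
    refine ⟨x, (Polynomial.mem_roots hQ0).2 ?_, hx.1, rfl⟩
    have h1 := hx.2
    rw [MvPolynomial.eval_eq_eval_mv_eval', ← ZMod.intCast_zmod_eq_zero_iff_dvd] at h1
    rw [Polynomial.IsRoot.def, hQ]
    have h2 := Polynomial.eval_map_apply (f := Int.castRingHom (ZMod p)) (p := q) x
    rw [Int.coe_castRingHom] at h2
    rw [h2]
    exact h1
  calc _ ≤ _ := Finset.card_le_card hsub
    _ ≤ Q.roots.toFinset.card * (B / p + 1) :=
      Finset.card_biUnion_le_card_mul _ _ _ fun t _ => (card_filter_intCast_eq p B t).2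
    _ ≤ _ := Nat.mul_le_mul_right _ hroots

/-- Primality can be dropped: the tail of `∑ 1/n²` is already small. -/
theorem sum_primes_inv_sq_le (M B : ℕ) :
    ∑ p ∈ (Finset.Ioc M B).filter Nat.Prime, ((p : ℝ) ^ 2)⁻¹ ≤ 2 / (M + 1) := by
  refine le_trans (Finset.sum_le_sum_of_subset_of_nonneg ?_ fun _ _ _ => by positivity)
    (sum_Ioo_inv_sq_le M (B + 1))
  intro p hp
  simp only [Finset.mem_filter, Finset.mem_Ioc, Finset.mem_Ioo] at hp ⊢
  omega

/-! ### Induction along lines in the first variable -/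

/-- The coefficients with respect to the first variable of the members of `S`. -/
def coeffSet {r : ℕ} (S : Set (MvPolynomial (Fin (r + 1)) ℤ)) : Set (MvPolynomial (Fin r) ℤ) :=
  ⋃ f ∈ S, Set.range (MvPolynomial.finSuccEquiv ℤ r f).coeff

theorem coeffSet_finite {r : ℕ} {S : Set (MvPolynomial (Fin (r + 1)) ℤ)} (hS : S.Finite) :
    (coeffSet S).Finite := by
  classical
  refine hS.biUnion fun f _ => ?_
  set q := MvPolynomial.finSuccEquiv ℤ r f
  refine (Finset.finite_toSet (insert 0 (q.support.image q.coeff))).subset ?_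
  rintro _ ⟨k, rfl⟩
  by_cases hk : q.coeff k = 0
  · simp [hk]
  · simp only [Finset.coe_insert, Set.mem_insert_iff, hk, false_or, Finset.coe_image]
    exact ⟨k, by simpa using hk, rfl⟩

/-- The value at `n` of a polynomial in the ideal generated by `S` is divisible by every common
divisor of the values at `n` of the members of `S`. -/
theorem dvd_eval_of_mem_span {σ : Type*} {S : Set (MvPolynomial σ ℤ)} {g : MvPolynomial σ ℤ}
    (hg : g ∈ Ideal.span S) {n : σ → ℤ} {p : ℤ} (h : ∀ f ∈ S, p ∣ MvPolynomial.eval n f) :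
    p ∣ MvPolynomial.eval n g := by
  have h1 : Ideal.span S ≤ (Ideal.span {p}).comap (MvPolynomial.eval n) :=
    Ideal.span_le.2 fun f hf => Ideal.mem_span_singleton.2 (h f hf)
  exact Ideal.mem_span_singleton.1 (h1 hg)

open Classical in
/-- Bad points on a line in the direction of the first variable. -/
theorem card_line_badPoints_le {r : ℕ} {S : Set (MvPolynomial (Fin (r + 1)) ℤ)} {d : ℕ}
    (hd : ∀ f ∈ S, f.degreeOf 0 ≤ d) {g : MvPolynomial (Fin r) ℤ}
    (hgS : (MvPolynomial.finSuccEquiv ℤ r).symm (Polynomial.C g) ∈ Ideal.span S)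
    {C e : ℕ} {M B : ℕ} (hB : 2 ≤ B) {a : Fin r → ℤ} (ha : a ∈ box r B)
    (hC : |MvPolynomial.eval a g| ≤ C * (B : ℤ) ^ e) :
    (((Finset.Ico (0 : ℤ) B).filter fun x =>
        (Fin.cons x a : Fin (r + 1) → ℤ) ∈ badPoints S M B).card : ℝ) ≤
      (if a ∈ badPoints (coeffSet S) M B then (B : ℝ) else 0) +
      (if MvPolynomial.eval a g = 0 then (B : ℝ) else 0) +
      ∑ p ∈ (Finset.Ioc M B).filter Nat.Prime,
        (if (p : ℤ) ∣ MvPolynomial.eval a g then 2 * d * (B : ℝ) / p else 0) +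
      d * (C + e) := by
  set L := (Finset.Ico (0 : ℤ) B).filter fun x =>
        (Fin.cons x a : Fin (r + 1) → ℤ) ∈ badPoints S M B with hL
  have hLB : (L.card : ℝ) ≤ B := by
    have : L.card ≤ B := (Finset.card_filter_le _ _).trans (by simp)
    exact_mod_cast this
  have hsum : 0 ≤ ∑ p ∈ (Finset.Ioc M B).filter Nat.Prime,
        (if (p : ℤ) ∣ MvPolynomial.eval a g then 2 * d * (B : ℝ) / p else 0) :=
    Finset.sum_nonneg fun p _ => by positivity
  have hde : (0 : ℝ) ≤ d * (C + e) := by positivity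
  by_cases hJ : a ∈ badPoints (coeffSet S) M B
  · have : (0 : ℝ) ≤ if MvPolynomial.eval a g = 0 then (B : ℝ) else 0 := by positivity
    rw [if_pos hJ]
    linarith
  by_cases hg0 : MvPolynomial.eval a g = 0
  · rw [if_pos hg0, if_neg hJ]
    linarith
  rw [if_neg hJ, if_neg hg0, zero_add, zero_add]
  set N := MvPolynomial.eval a g
  set F := N.natAbs.primeFactors.filter fun p => M < p
  have hF : ∀ p ∈ F, p.Prime ∧ M < p ∧ (p : ℤ) ∣ N := by
    intro p hp
    rw [Finset.mem_filter] at hp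
    exact ⟨Nat.prime_of_mem_primeFactors hp.1, hp.2,
      Int.natCast_dvd.2 (Nat.dvd_of_mem_primeFactors hp.1)⟩
  set Lp : ℕ → Finset ℤ := fun p => (Finset.Ico (0 : ℤ) B).filter fun x =>
    ∀ f ∈ S, (p : ℤ) ∣ MvPolynomial.eval (Fin.cons x a : Fin (r + 1) → ℤ) f
  -- Since `g` lies in the ideal and is constant on the line, each bad prime divides `N`.
  have hsub : L ⊆ F.biUnion Lp := by
    intro x hx
    simp only [hL, badPoints, Finset.mem_filter] at hx
    obtain ⟨hxB, -, p, hp, hM, hpS⟩ := hx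
    have hpN : (p : ℤ) ∣ N := by
      have := dvd_eval_of_mem_span hgS hpS
      rw [MvPolynomial.eval_eq_eval_mv_eval'] at this
      simpa using this
    refine Finset.mem_biUnion.2 ⟨p, ?_, Finset.mem_filter.2 ⟨hxB, hpS⟩⟩
    refine Finset.mem_filter.2 ⟨Nat.mem_primeFactors.2 ⟨hp, Int.natCast_dvd.1 hpN, ?_⟩, hM⟩
    simpa using hg0
  have hLp : ∀ p ∈ F, (Lp p).card ≤ d * (B / p + 1) := by
    intro p hp
    obtain ⟨hpp, hM, -⟩ := hF p hp
    have h1 : ¬ ∀ h ∈ coeffSet S, (p : ℤ) ∣ MvPolynomial.eval a h := fun h =>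
      hJ (Finset.mem_filter.2 ⟨ha, p, hpp, hM, h⟩)
    push Not at h1
    obtain ⟨h, hh, hph⟩ := h1
    simp only [coeffSet, Set.mem_iUnion, Set.mem_range] at hh
    obtain ⟨f, hf, k, rfl⟩ := hh
    refine (Finset.card_le_card ?_).trans (card_line_dvd_eval_le hpp a (hd f hf) hph)
    exact Finset.monotone_filter_right _ fun x _ hx => hx f hf
  have hcard : (L.card : ℝ) ≤ ∑ p ∈ F, ((Lp p).card : ℝ) := by
    exact_mod_cast (Finset.card_le_card hsub).trans Finset.card_biUnion_le
  refine hcard.trans ?_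
  -- Above `B` the quotient `B / p` is 0, so each prime costs at most `d` points, and at most `C +
  -- e` such primes divide `N`.
  rw [← Finset.sum_filter_add_sum_filter_not F (fun p => p ≤ B)]
  refine add_le_add ?_ ?_
  · rw [← Finset.sum_filter]
    have hsub' : F.filter (fun p => p ≤ B) ⊆
        ((Finset.Ioc M B).filter Nat.Prime).filter fun p => (p : ℤ) ∣ N := by
      intro p hp
      rw [Finset.mem_filter] at hp
      obtain ⟨h1, h2, h3⟩ := hF p hp.1
      simp only [Finset.mem_filter, Finset.mem_Ioc]
      exact ⟨⟨⟨h2, hp.2⟩, h1⟩, h3⟩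
    refine le_trans (Finset.sum_le_sum fun p hp => ?_)
      (Finset.sum_le_sum_of_subset_of_nonneg hsub' fun _ _ _ => by positivity)
    rw [Finset.mem_filter] at hp
    have h1 : ((Lp p).card : ℝ) ≤ d * ((B / p + 1 : ℕ) : ℝ) := by exact_mod_cast hLp p hp.1
    refine h1.trans ?_
    have h2 := natCast_div_add_one_le (hF p hp.1).1.pos hp.2
    calc (d : ℝ) * ((B / p + 1 : ℕ) : ℝ) ≤ d * (2 * B / p) := by gcongr
      _ = _ := by ring
  · have h1 : ∀ p ∈ F.filter (fun p => ¬ p ≤ B), ((Lp p).card : ℝ) ≤ d := by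
      intro p hp
      rw [Finset.mem_filter, not_le] at hp
      have := hLp p hp.1
      rw [Nat.div_eq_of_lt hp.2, zero_add, mul_one] at this
      exact_mod_cast this
    have h2 : (F.filter fun p => ¬ p ≤ B).card ≤ C + e :=
      card_primes_dvd_le hB hg0 hC _ fun p hp => by
        rw [Finset.mem_filter, not_le] at hp
        exact ⟨(hF p hp.1).1, hp.2, (hF p hp.1).2.2⟩
    have h3 := Finset.sum_le_card_nsmul _ _ _ h1
    rw [nsmul_eq_mul] at h3
    refine h3.trans ?_
    rw [mul_comm]
    gcongr
    exact_mod_cast h2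

open Classical in
theorem card_badPoints_le_sum {r : ℕ} (S : Set (MvPolynomial (Fin (r + 1)) ℤ)) (M B : ℕ) :
    (badPoints S M B).card ≤ ∑ a ∈ box r B, ((Finset.Ico (0 : ℤ) B).filter fun x =>
        (Fin.cons x a : Fin (r + 1) → ℤ) ∈ badPoints S M B).card := by
  rw [Finset.card_eq_sum_card_fiberwise (f := Fin.tail) (t := box r B)]
  · refine Finset.sum_le_sum fun a _ => ?_
    refine Finset.card_le_card_of_injOn (fun n => n 0) ?_ ?_
    · intro n hn
      simp only [Finset.coe_filter, Set.mem_ofPred_eq] at hn ⊢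
      obtain ⟨hn, rfl⟩ := hn
      have hn' := mem_box.1 (Finset.mem_filter.1 hn).1 0
      rw [Fin.cons_self_tail]
      exact ⟨Finset.mem_Ico.2 hn', hn⟩
    · intro n hn n' hn' h
      simp only [Finset.coe_filter, Set.mem_ofPred_eq] at hn hn' h
      rw [← Fin.cons_self_tail n, ← Fin.cons_self_tail n', hn.2, hn'.2, h]
  · intro n hn
    have hn' := mem_box.1 (Finset.mem_filter.1 hn).1
    exact mem_box.2 fun i => hn' i.succ

/-- The line bound is summed over `a`. The budget is `ε/2` for lines bad for the coefficients, `ε/4`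
for primes in `(M, B]`, and `ε/4` for zeros of `g` together with primes above `B`, which contribute
only O(B^r). -/
theorem IsThin.of_coeffSet {r : ℕ} {S : Set (MvPolynomial (Fin (r + 1)) ℤ)} (hS : S.Finite)
    {g : MvPolynomial (Fin r) ℤ} (hg : g ≠ 0)
    (hgS : (MvPolynomial.finSuccEquiv ℤ r).symm (Polynomial.C g) ∈ Ideal.span S)
    (hJ : IsThin (coeffSet S)) : IsThin S := by
  classical
  intro ε hε
  obtain ⟨d, hd⟩ : ∃ d, ∀ f ∈ S, f.degreeOf 0 ≤ d := by
    obtain ⟨d, hd⟩ := (hS.image (MvPolynomial.degreeOf 0)).bddAbove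
    exact ⟨d, fun f hf => hd ⟨f, hf, rfl⟩⟩
  obtain ⟨C, e, hC⟩ := exists_abs_eval_le g
  obtain ⟨M₁, hM₁⟩ := hJ (ε / 2) (by positivity)
  obtain ⟨M₂, hM₂⟩ := map_intCast_ne_zero hg
  set K : ℝ := 2 * d * (g.totalDegree * 2 ^ r) with hK
  have hK0 : 0 ≤ K := by positivity
  -- Makes the tail `K * 2 / (M + 1)` at most `ε / 4`.
  obtain ⟨M₃, hM₃⟩ := exists_nat_ge (8 * K / ε)
  set M := max M₁ (max M₂ M₃)
  refine ⟨M, ?_⟩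
  obtain ⟨B₀, hB₀⟩ := exists_nat_ge (4 * (g.totalDegree + d * (C + e)) / ε)
  filter_upwards [hM₁, Filter.eventually_ge_atTop 2, Filter.eventually_ge_atTop B₀]
    with B hJB hB2 hBB
  have hBpos : (0 : ℝ) < B := by positivity
  have hlines := Finset.sum_le_sum fun a (ha : a ∈ box r B) =>
    card_line_badPoints_le hd hgS (M := M) hB2 ha (hC B (by omega) a ha)
  have hcard : ((badPoints S M B).card : ℝ) ≤ ∑ a ∈ box r B,
      (((Finset.Ico (0 : ℤ) B).filter fun x =>
        (Fin.cons x a : Fin (r + 1) → ℤ) ∈ badPoints S M B).card : ℝ) := by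
    exact_mod_cast card_badPoints_le_sum S M B
  refine (hcard.trans hlines).trans ?_
  rw [Finset.sum_add_distrib, Finset.sum_add_distrib, Finset.sum_add_distrib, Finset.sum_comm]
  have e1 : ∑ a ∈ box r B, (if a ∈ badPoints (coeffSet S) M B then (B : ℝ) else 0) ≤
      ε / 2 * (B : ℝ) ^ (r + 1) := by
    rw [← Finset.sum_filter, Finset.sum_const, nsmul_eq_mul]
    have h1 : ((box r B).filter (· ∈ badPoints (coeffSet S) M B)).card ≤
        (badPoints (coeffSet S) M₁ B).card :=
      Finset.card_le_card fun a ha =>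
        badPoints_anti _ (le_max_left _ _) B (Finset.mem_filter.1 ha).2
    calc _ ≤ ((badPoints (coeffSet S) M₁ B).card : ℝ) * B := by gcongr
      _ ≤ ε / 2 * (B : ℝ) ^ r * B := by gcongr
      _ = _ := by ring
  have e2 : ∑ a ∈ box r B, (if MvPolynomial.eval a g = 0 then (B : ℝ) else 0) ≤
      g.totalDegree * (B : ℝ) ^ r := by
    rw [← Finset.sum_filter, Finset.sum_const, nsmul_eq_mul]
    calc _ ≤ (g.totalDegree / B * (B : ℝ) ^ r) * B := by
          gcongr
          exact card_eval_eq_zero_le hg B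
      _ = _ := by field_simp
  have e3 : ∑ p ∈ (Finset.Ioc M B).filter Nat.Prime, ∑ a ∈ box r B,
      (if (p : ℤ) ∣ MvPolynomial.eval a g then 2 * d * (B : ℝ) / p else 0) ≤
      ε / 4 * (B : ℝ) ^ (r + 1) := by
    have h1 : ∀ p ∈ (Finset.Ioc M B).filter Nat.Prime, ∑ a ∈ box r B,
        (if (p : ℤ) ∣ MvPolynomial.eval a g then 2 * d * (B : ℝ) / p else 0) ≤
        K * (B : ℝ) ^ (r + 1) * ((p : ℝ) ^ 2)⁻¹ := by
      intro p hp
      simp only [Finset.mem_filter, Finset.mem_Ioc] at hp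
      obtain ⟨⟨hMp, hpB⟩, hpp⟩ := hp
      have hp0 : (0 : ℝ) < p := by exact_mod_cast hpp.pos
      rw [← Finset.sum_filter, Finset.sum_const, nsmul_eq_mul]
      have hgp := hM₂ p (lt_of_le_of_lt ((le_max_left _ _).trans (le_max_right _ _)) hMp)
      calc _ ≤ (g.totalDegree * 2 ^ r * (B : ℝ) ^ r / p) * (2 * d * (B : ℝ) / p) := by
            gcongr
            exact card_dvd_eval_le hpp hpB hgp
        _ = _ := by rw [hK]; field_simp; ring
    refine (Finset.sum_le_sum h1).trans ?_
    rw [← Finset.mul_sum]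
    have h2 : (M₃ : ℝ) ≤ M := by
      exact_mod_cast (le_max_right M₂ M₃).trans (le_max_right _ _)
    have h3 : K * (2 / ((M : ℝ) + 1)) ≤ ε / 4 := by
      rw [div_le_iff₀ hε] at hM₃
      have hM0 : (0 : ℝ) < (M : ℝ) + 1 := by positivity
      rw [← mul_div_assoc, div_le_iff₀ hM0]
      nlinarith
    calc _ ≤ K * (B : ℝ) ^ (r + 1) * (2 / ((M : ℝ) + 1)) := by
          gcongr
          exact sum_primes_inv_sq_le M B
      _ = (K * (2 / ((M : ℝ) + 1))) * (B : ℝ) ^ (r + 1) := by ring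
      _ ≤ _ := by gcongr
  have e4 : ∑ a ∈ box r B, ((d : ℝ) * (C + e)) = d * (C + e) * (B : ℝ) ^ r := by
    rw [Finset.sum_const, nsmul_eq_mul, card_box]
    push_cast
    ring
  have e5 : (g.totalDegree + (d : ℝ) * (C + e)) * (B : ℝ) ^ r ≤ ε / 4 * (B : ℝ) ^ (r + 1) := by
    have h1 : 4 * (g.totalDegree + (d : ℝ) * (C + e)) / ε ≤ B :=
      hB₀.trans (by exact_mod_cast hBB)
    rw [div_le_iff₀ hε] at h1
    rw [pow_succ, mul_comm ((B : ℝ) ^ r), ← mul_assoc]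
    gcongr
    linarith
  rw [e4]
  linarith

/-- A finite set of integer polynomials, not all zero, without a common divisor of positive degree
is thin. -/
theorem isThin_of_no_common_divisor {r : ℕ} {S : Set (MvPolynomial (Fin r) ℤ)} (hS : S.Finite)
    (hS0 : ∃ f ∈ S, f ≠ 0)
    (hcop : ∀ D : MvPolynomial (Fin r) ℤ, (∀ f ∈ S, D ∣ f) → D.totalDegree = 0) : IsThin S := by
  induction r with
  | zero =>
    intro ε hε
    obtain ⟨f, hf, hf0⟩ := hS0
    rw [f.eq_C_of_isEmpty] at hf hf0
    set c := f.coeff 0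
    -- Common integer factors are allowed; a nonzero constant just has no prime divisor above its
    -- absolute value.
    refine ⟨c.natAbs, Filter.Eventually.of_forall fun B => ?_⟩
    have : badPoints S c.natAbs B = ∅ := by
      classical
      refine Finset.filter_eq_empty_iff.2 fun n _ => ?_
      rintro ⟨p, hp, hM, h⟩
      have h1 := h _ hf
      rw [MvPolynomial.eval_C, Int.natCast_dvd] at h1
      have h2 : c = 0 := by simpa using Nat.eq_zero_of_dvd_of_lt h1 hM
      exact hf0 (by rw [h2, map_zero])
    rw [this]
    simp only [Finset.card_empty, Nat.cast_zero]
    positivity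
  | succ r ih =>
    set E := MvPolynomial.finSuccEquiv ℤ r
    obtain ⟨g, hg, hgS⟩ := exists_C_mem_span_of_no_common_divisor (E '' S) fun D hD => by
      have h1 : (E.symm D).totalDegree = 0 := hcop _ fun f hf => by
        have := map_dvd E.symm (hD _ ⟨f, hf, rfl⟩)
        simpa using this
      have h2 := MvPolynomial.natDegree_finSuccEquiv (E.symm D)
      have h3 := MvPolynomial.degreeOf_le_totalDegree (E.symm D) 0
      rw [show MvPolynomial.finSuccEquiv ℤ r (E.symm D) = D from E.apply_symm_apply D] at h2
      omega
    have hgS' : E.symm (Polynomial.C g) ∈ Ideal.span S := by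
      have h1 := Ideal.mem_map_of_mem E.symm.toRingHom hgS
      rw [Ideal.map_span, Set.image_image] at h1
      simpa using h1
    refine IsThin.of_coeffSet hS hg hgS' (ih (coeffSet_finite hS) ?_ ?_)
    · obtain ⟨f, hf, hf0⟩ := hS0
      have h1 : E f ≠ 0 := by simpa using hf0
      exact ⟨(E f).leadingCoeff,
        Set.mem_biUnion hf ⟨_, rfl⟩, Polynomial.leadingCoeff_ne_zero.2 h1⟩
    -- A common divisor of all coefficients, viewed as constant in the first variable, divides every
    -- member of `S`.
    · intro D hD
      have h1 : (E.symm (Polynomial.C D)).totalDegree = 0 := hcop _ fun f hf => by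
        have h2 : Polynomial.C D ∣ E f :=
          Polynomial.C_dvd_iff_dvd_coeff _ _ |>.2 fun k => hD _ (Set.mem_biUnion hf ⟨k, rfl⟩)
        have := map_dvd E.symm h2
        simpa using this
      by_contra hD0
      have h2 : (E (E.symm (Polynomial.C D))).coeff 0 = D := by simp
      have h3 := MvPolynomial.totalDegree_coeff_finSuccEquiv_add_le (E.symm (Polynomial.C D)) 0
        (by rw [h2]; rintro rfl; simp at hD0)
      rw [h2] at h3
      omega

/-! ### Densities of finite sieves -/

theorem tendsto_natDiv_div (m : ℕ) :
    Filter.Tendsto (fun B : ℕ => ((B / m : ℕ) : ℝ) / B) Filter.atTop (nhds (1 / m : ℝ)) := by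
  have h := (tendsto_nat_floor_mul_div_atTop (R := ℝ) (a := 1 / m) (by positivity)).comp
    tendsto_natCast_atTop_atTop
  refine h.congr fun B => ?_
  simp only [Function.comp_apply]
  rw [one_div_mul_eq_div, Nat.floor_div_eq_div]

theorem ncard_inter_box {r : ℕ} (S : Set (Fin r → ℤ)) [DecidablePred (· ∈ S)] (B : ℕ) :
    (S ∩ (box r B : Set (Fin r → ℤ))).ncard = ((box r B).filter (· ∈ S)).card := by
  rw [← Set.ncard_coe_finset]
  congr 1
  ext n
  simp [and_comm]

open Classical in
/-- A union of residue classes modulo `m` has the expected density. -/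
theorem hasDensity_reduction {r : ℕ} (m : ℕ) [NeZero m] (T : Finset (Fin r → ZMod m)) :
    HasDensity {n : Fin r → ℤ | (fun i => (n i : ZMod m)) ∈ T} ((T.card : ℝ) / (m : ℝ) ^ r) := by
  have hlow : Filter.Tendsto (fun B : ℕ => (T.card : ℝ) * (((B / m : ℕ) : ℝ) / B) ^ r)
      Filter.atTop (nhds (T.card / (m : ℝ) ^ r)) := by
    have := ((tendsto_natDiv_div m).pow r).const_mul (T.card : ℝ)
    simpa [div_eq_mul_inv] using this
  have hup : Filter.Tendsto (fun B : ℕ => (T.card : ℝ) * (((B / m : ℕ) : ℝ) / B + 1 / B) ^ r)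
      Filter.atTop (nhds (T.card / (m : ℝ) ^ r)) := by
    have := (((tendsto_natDiv_div m).add tendsto_one_div_atTop_nhds_zero_nat).pow r).const_mul
      (T.card : ℝ)
    simpa [div_eq_mul_inv] using this
  refine tendsto_of_tendsto_of_tendsto_of_le_of_le' hlow hup ?_ ?_
  · filter_upwards [Filter.eventually_gt_atTop 0] with B hB
    have hB' : (0 : ℝ) < B := by exact_mod_cast hB
    rw [ncard_inter_box, card_box, Nat.cast_pow, div_pow, ← mul_div_assoc]
    gcongr
    exact_mod_cast (card_box_filter_reduction m B T).1
  · filter_upwards [Filter.eventually_gt_atTop 0] with B hB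
    have hB' : (0 : ℝ) < B := by exact_mod_cast hB
    rw [ncard_inter_box, card_box, Nat.cast_pow, ← add_div, div_pow, ← mul_div_assoc]
    gcongr
    exact_mod_cast (card_box_filter_reduction m B T).2

/-- The points at which no prime in `F` divides all values. -/
def sievedSet {r s : ℕ} (P : Fin s → MvPolynomial (Fin r) ℤ) (F : Finset Nat.Primes) :
    Set (Fin r → ℤ) :=
  {n | ∀ p ∈ F, ¬ ∀ i, ((p : ℕ) : ℤ) ∣ MvPolynomial.eval n (P i)}

theorem hasDensity_sievedSet {r s : ℕ} (P : Fin s → MvPolynomial (Fin r) ℤ)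
    (F : Finset Nat.Primes) :
    HasDensity (sievedSet P F)
      (∏ p ∈ F, (1 - (commonZeros P (p : ℕ) : ℝ) / ((p : ℕ) : ℝ) ^ r)) := by
  classical
  have hne (p : Nat.Primes) : NeZero (p : ℕ) := ⟨p.2.ne_zero⟩
  have hcop : Pairwise (Function.onFun Nat.Coprime fun p : F => ((p : Nat.Primes) : ℕ)) := by
    intro p q hpq
    refine (Nat.coprime_primes p.1.2 q.1.2).2 fun h => hpq ?_
    exact Subtype.ext (Subtype.ext h)
  set m : ℕ := ∏ p : F, ((p : Nat.Primes) : ℕ) with hm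
  have : NeZero m := ⟨Finset.prod_ne_zero_iff.2 fun p _ => p.1.2.ne_zero⟩
  let Z (p : ℕ) : Set (Fin r → ZMod p) := {x |
    ∀ i, MvPolynomial.eval x (MvPolynomial.map (Int.castRingHom (ZMod p)) (P i)) = 0}
  -- The Chinese remainder theorem in each coordinate, then a swap of coordinates and primes; the
  -- allowed residues become a product set.
  let e : (Fin r → ZMod m) ≃ ((p : F) → Fin r → ZMod ((p : Nat.Primes) : ℕ)) :=
    (Equiv.arrowCongr (Equiv.refl _) (ZMod.prodEquivPi _ hcop).toEquiv).trans
      (Equiv.piComm _)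
  let V (p : F) : Finset (Fin r → ZMod ((p : Nat.Primes) : ℕ)) := (Z (p : Nat.Primes)).toFinsetᶜ
  let T : Finset (Fin r → ZMod m) := Finset.univ.filter fun x => e x ∈ Fintype.piFinset V
  have hT : T.card = ∏ p : F, (V p).card := by
    rw [← Fintype.card_piFinset]
    exact Finset.card_equiv e fun x => by simp [T]
  have hV (p : F) : ((V p).card : ℝ) / (((p : Nat.Primes) : ℕ) : ℝ) ^ r =
      1 - (commonZeros P ((p : Nat.Primes) : ℕ) : ℝ) / (((p : Nat.Primes) : ℕ) : ℝ) ^ r := by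
    have hp0 : (((p : Nat.Primes) : ℕ) : ℝ) ^ r ≠ 0 :=
      pow_ne_zero _ (Nat.cast_ne_zero.2 p.1.2.ne_zero)
    have h1 : (V p).card + commonZeros P ((p : Nat.Primes) : ℕ) = ((p : Nat.Primes) : ℕ) ^ r := by
      have h2 : commonZeros P ((p : Nat.Primes) : ℕ) = (Z (p : Nat.Primes)).toFinset.card :=
        Set.ncard_eq_toFinset_card' _
      rw [h2, Finset.card_compl_add_card, Fintype.card_fun, ZMod.card, Fintype.card_fin]
    rw [eq_sub_iff_add_eq, ← add_div, div_eq_one_iff_eq hp0]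
    exact_mod_cast h1
  have hset : sievedSet P F = {n : Fin r → ℤ | (fun i => (n i : ZMod m)) ∈ T} := by
    ext n
    have he (p : F) : e (fun i => (n i : ZMod m)) p =
        fun i => (n i : ZMod ((p : Nat.Primes) : ℕ)) := by
      funext i
      change ZMod.prodEquivPi _ hcop (n i : ZMod m) p = _
      rw [map_intCast, Pi.intCast_apply]
    simp only [sievedSet, T, Set.mem_ofPred_eq, Finset.mem_filter, Finset.mem_univ, true_and,
      Fintype.mem_piFinset, he, V, Finset.mem_compl, Set.mem_toFinset, Z, eval_map_intCast,
      ZMod.intCast_zmod_eq_zero_iff_dvd, Subtype.forall]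
  rw [hset]
  convert hasDensity_reduction m T using 1
  rw [hT, hm, Nat.cast_prod, Nat.cast_prod, ← Finset.prod_pow, ← Finset.prod_div_distrib,
    ← Finset.prod_coe_sort]
  exact Finset.prod_congr rfl fun p _ => (hV p).symm

/-! ### From finite sieves to the infinite product -/

theorem sievedSet_inter_box_subset {r s : ℕ} (P : Fin s → MvPolynomial (Fin r) ℤ)
    {F : Finset Nat.Primes} {M : ℕ} (hF : ∀ p : Nat.Primes, (p : ℕ) ≤ M → p ∈ F) (B : ℕ) :
    sievedSet P F ∩ (box r B : Set (Fin r → ℤ)) ⊆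
      (coprimeValueSet P ∩ (box r B : Set (Fin r → ℤ))) ∪ badPoints (Set.range P) M B := by
  classical
  rintro n ⟨hn, hnB⟩
  by_cases h : n ∈ coprimeValueSet P
  · exact Or.inl ⟨h, hnB⟩
  right
  set G := Finset.univ.gcd fun i => MvPolynomial.eval n (P i) with hG
  have hG1 : G.natAbs ≠ 1 := by
    intro h1
    refine h ?_
    have h2 : normalize G = G := Finset.normalize_gcd
    rw [← Int.abs_eq_normalize, Int.abs_eq_natAbs, h1] at h2
    exact h2.symm
  -- This includes `G = 0`. Nothing yet makes `p` large; the sieve excludes `p ≤ M`.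
  obtain ⟨p, hp, hpG⟩ := Nat.exists_prime_and_dvd hG1
  have hdiv : ∀ i, (p : ℤ) ∣ MvPolynomial.eval n (P i) := fun i =>
    (Int.natCast_dvd.2 hpG).trans (Finset.gcd_dvd (Finset.mem_univ i))
  refine Finset.mem_coe.2 (Finset.mem_filter.2 ⟨hnB, p, hp, ?_, ?_⟩)
  · by_contra hle
    exact hn ⟨p, hp⟩ (hF ⟨p, hp⟩ (not_lt.1 hle)) hdiv
  · rintro _ ⟨i, rfl⟩
    exact hdiv i

theorem coprimeValueSet_subset_sievedSet {r s : ℕ} (P : Fin s → MvPolynomial (Fin r) ℤ)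
    (F : Finset Nat.Primes) : coprimeValueSet P ⊆ sievedSet P F := by
  intro n hn p _ h
  have h1 : ((p : ℕ) : ℤ) ∣ 1 := by
    rw [← show Finset.univ.gcd (fun i => MvPolynomial.eval n (P i)) = 1 from hn]
    exact Finset.dvd_gcd fun i _ => h i
  exact p.2.one_lt.ne' (Nat.dvd_one.1 (by exact_mod_cast h1))

/-- A sieve by primes above `M` only removes bad points. -/
theorem box_subset_sievedSet_union {r s : ℕ} (P : Fin s → MvPolynomial (Fin r) ℤ)
    {F : Finset Nat.Primes} {M : ℕ} (hF : ∀ p ∈ F, M < (p : ℕ)) (B : ℕ) :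
    (box r B : Set (Fin r → ℤ)) ⊆
      (sievedSet P F ∩ (box r B : Set (Fin r → ℤ))) ∪ badPoints (Set.range P) M B := by
  classical
  intro n hnB
  by_cases h : n ∈ sievedSet P F
  · exact Or.inl ⟨h, hnB⟩
  right
  simp only [sievedSet, Set.mem_ofPred_eq] at h
  push Not at h
  obtain ⟨p, hpF, h⟩ := h
  refine Finset.mem_coe.2 (Finset.mem_filter.2 ⟨hnB, p, p.2, hF p hpF, ?_⟩)
  rintro _ ⟨i, rfl⟩
  exact h i

theorem ncard_le_add_badPoints {r : ℕ} {X Y : Set (Fin r → ℤ)} {Z : Finset (Fin r → ℤ)} {B : ℕ}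
    (h : X ⊆ (Y ∩ (box r B : Set (Fin r → ℤ))) ∪ Z) :
    (X.ncard : ℝ) ≤ (Y ∩ (box r B : Set (Fin r → ℤ))).ncard + Z.card := by
  have hfin : ((Y ∩ (box r B : Set (Fin r → ℤ))) ∪ Z).Finite :=
    ((box r B).finite_toSet.inter_of_right _).union Z.finite_toSet
  have h1 := (Set.ncard_le_ncard h hfin).trans (Set.ncard_union_le _ _)
  rw [Set.ncard_coe_finset] at h1
  exact_mod_cast h1

/-- A common divisor over ℤ keeps its degree over ℚ, as ℤ embeds in ℚ. -/
theorem isThin_range {r s : ℕ} {P : Fin s → MvPolynomial (Fin r) ℤ} (hP : ∃ i, P i ≠ 0)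
    (hcop : CoprimePolys P) : IsThin (Set.range P) := by
  refine isThin_of_no_common_divisor (Set.finite_range P) ?_ fun D hD => ?_
  · obtain ⟨i, hi⟩ := hP
    exact ⟨P i, ⟨i, rfl⟩, hi⟩
  · by_contra hD0
    refine hcop ⟨MvPolynomial.map (Int.castRingHom ℚ) D, ?_, fun i => map_dvd _ (hD _ ⟨i, rfl⟩)⟩
    have : (MvPolynomial.map (Int.castRingHom ℚ) D).totalDegree = D.totalDegree := by
      simp only [MvPolynomial.totalDegree]
      rw [MvPolynomial.support_map_of_injective _ (RingHom.injective_int _)]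
    omega

theorem commonZeros_div_nonneg {r s : ℕ} (P : Fin s → MvPolynomial (Fin r) ℤ) (p : ℕ) :
    0 ≤ (commonZeros P p : ℝ) / (p : ℝ) ^ r := by positivity

theorem commonZeros_div_le_one {r s : ℕ} (P : Fin s → MvPolynomial (Fin r) ℤ) (p : Nat.Primes) :
    (commonZeros P (p : ℕ) : ℝ) / ((p : ℕ) : ℝ) ^ r ≤ 1 := by
  have : NeZero (p : ℕ) := ⟨p.2.ne_zero⟩
  refine div_le_one_of_le₀ ?_ (by positivity)
  have h := Set.ncard_le_card {x : Fin r → ZMod p |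
    ∀ i, MvPolynomial.eval x (MvPolynomial.map (Int.castRingHom (ZMod p)) (P i)) = 0}
  rw [Nat.card_fun, Nat.card_zmod, Nat.card_fin] at h
  exact_mod_cast h

/-- Sieving by any finite set of primes above a suitable `M` removes at most half the points, so its
density, a partial product, is at least 1/2. With `1 - x ≤ exp (-x)` this bounds all partial sums
beyond `M` by `log 2`. -/
theorem summable_commonZeros {r s : ℕ} {P : Fin s → MvPolynomial (Fin r) ℤ}
    (hthin : IsThin (Set.range P)) :
    Summable fun p : Nat.Primes => (commonZeros P (p : ℕ) : ℝ) / ((p : ℕ) : ℝ) ^ r := by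
  classical
  set a : Nat.Primes → ℝ := fun p => (commonZeros P (p : ℕ) : ℝ) / ((p : ℕ) : ℝ) ^ r with ha
  obtain ⟨M, hM⟩ := hthin (1 / 2) (by norm_num)
  have hprod : ∀ F : Finset Nat.Primes, (∀ p ∈ F, M < (p : ℕ)) →
      1 / 2 ≤ ∏ p ∈ F, (1 - a p) := by
    intro F hF
    refine ge_of_tendsto (hasDensity_sievedSet P F) ?_
    filter_upwards [hM, Filter.eventually_gt_atTop 0] with B hB hB0
    have hBr : (0 : ℝ) < (B : ℝ) ^ r := by positivity
    have h1 := ncard_le_add_badPoints (box_subset_sievedSet_union P hF B)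
    rw [Set.ncard_coe_finset, card_box] at h1
    rw [card_box, Nat.cast_pow, le_div_iff₀ hBr]
    push_cast at h1
    linarith
  have hsum : ∀ F : Finset Nat.Primes, (∀ p ∈ F, M < (p : ℕ)) →
      ∑ p ∈ F, a p ≤ Real.log 2 := by
    intro F hF
    have h1 : ∏ p ∈ F, (1 - a p) ≤ Real.exp (-∑ p ∈ F, a p) := by
      rw [← Finset.sum_neg_distrib, Real.exp_sum]
      exact Finset.prod_le_prod (fun p _ => sub_nonneg.2 (commonZeros_div_le_one P p))
        fun p _ => Real.one_sub_le_exp_neg _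
    have h2 := Real.log_le_log (by norm_num) ((hprod F hF).trans h1)
    rw [Real.log_exp, one_div, Real.log_inv] at h2
    linarith
  have hfin : {p : Nat.Primes | (p : ℕ) ≤ M}.Finite :=
    (Set.finite_Iic M).preimage Subtype.val_injective.injOn
  have hsub : Summable (a ∘ ((↑) : ((hfin.toFinset : Set Nat.Primes)ᶜ : Set _) → Nat.Primes)) := by
    refine summable_of_sum_le (c := Real.log 2) (fun p => commonZeros_div_nonneg P _) fun F => ?_
    have := hsum (F.map (Function.Embedding.subtype _)) (by
      intro p hp
      obtain ⟨q, -, rfl⟩ := Finset.mem_map.1 hp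
      have := q.2
      simpa using this)
    rw [Finset.sum_map] at this
    exact this
  exact (Finset.summable_compl_iff hfin.toFinset).1 hsub

/-- The set lies inside every finite sieve and, once `F` contains all primes up to `M`, differs from
it in the box only by bad points. -/
theorem hasDensity_coprimeValueSet {r s : ℕ} {P : Fin s → MvPolynomial (Fin r) ℤ}
    (hthin : IsThin (Set.range P)) {d : ℝ}
    (hd : HasProd (fun p : Nat.Primes =>
      1 - (commonZeros P (p : ℕ) : ℝ) / ((p : ℕ) : ℝ) ^ r) d) :
    HasDensity (coprimeValueSet P) d := by
  classical
  rw [HasDensity, Metric.tendsto_atTop']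
  intro ε hε
  suffices h : ∀ᶠ B : ℕ in Filter.atTop, dist
      (((coprimeValueSet P ∩ (box r B : Set (Fin r → ℤ))).ncard : ℝ) / ((box r B).card : ℝ)) d <
        ε by
    obtain ⟨N, hN⟩ := Filter.eventually_atTop.1 h
    exact ⟨N, fun B hB => hN B hB.le⟩
  obtain ⟨M, hM⟩ := hthin (ε / 3) (by positivity)
  have hfin : {p : Nat.Primes | (p : ℕ) ≤ M}.Finite :=
    (Set.finite_Iic M).preimage Subtype.val_injective.injOn
  -- One finite `F` must both bring the product within `ε / 3` of `d` and contain every prime up to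
  -- `M`; the other two thirds go to bad points and to the density of the sieve.
  obtain ⟨F, hF1, hF2⟩ := ((Metric.tendsto_nhds.1 hd (ε / 3) (by positivity)).and
    (Filter.eventually_ge_atTop hfin.toFinset)).exists
  have hFM : ∀ p : Nat.Primes, (p : ℕ) ≤ M → p ∈ F := fun p hp =>
    hF2 (by simpa using hp)
  filter_upwards [hM, Metric.tendsto_nhds.1 (hasDensity_sievedSet P F) (ε / 3) (by positivity),
    Filter.eventually_gt_atTop 0] with B hB hU hB0
  have hBr : (0 : ℝ) < (box r B).card := by
    rw [card_box]
    positivity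
  have h1 := ncard_le_add_badPoints (sievedSet_inter_box_subset P hFM B)
  have h2 : ((coprimeValueSet P ∩ (box r B : Set (Fin r → ℤ))).ncard : ℝ) ≤
      (sievedSet P F ∩ (box r B : Set (Fin r → ℤ))).ncard := by
    exact_mod_cast Set.ncard_le_ncard
      (Set.inter_subset_inter_left _ (coprimeValueSet_subset_sievedSet P F))
      ((box r B).finite_toSet.inter_of_right _)
  have h3 := div_le_div_of_nonneg_right h2 hBr.le
  have h4 := div_le_div_of_nonneg_right h1 hBr.le
  have h5 : ((badPoints (Set.range P) M B).card : ℝ) / (box r B).card ≤ ε / 3 := by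
    rw [div_le_iff₀ hBr, card_box]
    exact_mod_cast hB
  rw [add_div] at h4
  rw [Real.dist_eq, abs_lt] at hU hF1 ⊢
  constructor <;> linarith

end EkedahlPoonen

theorem theorem1p5 (r s : ℕ) (hr : 1 ≤ r) (hs : 2 ≤ s)
    (P : Fin s → MvPolynomial (Fin r) ℤ) (hP : ∀ i, P i ≠ 0)
    (hcop : EkedahlPoonen.CoprimePolys P) :
    Multipliable (fun p : Nat.Primes =>
        1 - (EkedahlPoonen.commonZeros P (p : ℕ) : ℝ) / ((p : ℕ) : ℝ) ^ r) ∧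
      EkedahlPoonen.HasDensity (EkedahlPoonen.coprimeValueSet P)
        (∏' p : Nat.Primes,
          (1 - (EkedahlPoonen.commonZeros P (p : ℕ) : ℝ) / ((p : ℕ) : ℝ) ^ r)) := by
  have hthin := EkedahlPoonen.isThin_range ⟨⟨0, by omega⟩, hP _⟩ hcop
  have hmul : Multipliable (fun p : Nat.Primes =>
      1 - (EkedahlPoonen.commonZeros P (p : ℕ) : ℝ) / ((p : ℕ) : ℝ) ^ r) := by
    simpa only [sub_eq_add_neg] using
      Real.multipliable_one_add_of_summable (EkedahlPoonen.summable_commonZeros hthin).neg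
  exact ⟨hmul, EkedahlPoonen.hasDensity_coprimeValueSet hthin hmul.hasProd⟩
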